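/- Let $\theta$ be a probability distribution on $\{0,\dots,N\}$ with mean $m=\sum_{k=1}^N k\,\theta_k>1$, and let $\tau$ be the Galton–Watson tree with offspring distribution $\theta$: the numbers of children of the nodes are independent with law $\theta$. Let $F_\tau$ be its Gromov boundary, the set of infinite descending paths from the root, with the metric $d(x,y)=2^{-|x\wedge y|}$ for $x\neq y$, where $|x\wedge y|$ is the level of the last common ancestor of $x$ and $y$. For a set $F$ in a metric space let $N_r(A)$ be the least number of sets of radius at most $r$ (that is, contained in a closed ball of radius $r$) that cover $A$, and let $B(x,R)$ be the closed ball. The Assouad dimension $\dim_{\mathrm A}F$ is the infimum of all $s\in\mathbb R$ for which there is $K>0$ with $$N_r(F\cap B(x,R))\le K\,(R/r)^s\qquad\text{for all } x\in F \text{ and } 0<r\le R<1,$$ and, for a function $\phi$, the $\phi$-Assouad dimension $\dim_{\mathrm A}^{\phi}F$ is the infimum of all $s\in\mathbb R$ for which there is $K>0$ such that this inequality holds for all $x\in F$ and all $0<r=R^{1+\phi(R)}<R<1$. A dimension function is a real function $\phi$ such that, on some interval $(0,\delta)$ with $0<\delta\le 1$, $\phi$ is positive and both $\phi(x)$ and $\phi(x)|\log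 x|$ are monotone (each either non-decreasing or non-increasing). Then there is a constant $C>0$, depending only on $\theta$, such that, almost surely conditioned on non-extinction of $\tau$, $$\dim_{\mathrm A}^{\phi}F_\tau=\dim_{\mathrm A}F_\tau$$ simultaneously for all dimension functions $\phi$ with $\phi(x)|\log x|\to\infty$ as $x\to 0^+$ and $$\phi(x)\le C\,\frac{\log|\log x|}{|\log x|}\qquad\text{for all sufficiently small } x>0.$$ -/

import Mathlib

open MeasureTheory ProbabilityTheory Filter Topology Set
open scoped ENNReal NNReal

/-- Nodes of the Ulam-Harris tree are finite lists of labels, the *last* step being the head of the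
list, so that the children of `v` are `0 :: v, 1 :: v, ...` and the root is `[]`.
Given the number `c v` of children of every potential node `v`, `IsNode c v` says that `v` belongs
to the tree in which each node `v` has exactly the children `i :: v` with `i < c v`. -/
def IsNode (c : List ℕ → ℕ) : List ℕ → Prop
  | [] => True
  | i :: v => IsNode c v ∧ i < c v

/-- The nodes at level `k` of the tree with offspring numbers `c`; the number of them is `Z_k`. -/
def generation (c : List ℕ → ℕ) (k : ℕ) : Set (List ℕ) :=
  {v | IsNode c v ∧ v.length = k}

/-- Non-extinction: no generation is empty. -/
def Survives (c : List ℕ → ℕ) : Prop :=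
  ∀ k : ℕ, (generation c k).Nonempty

/-- Infinite descending paths from the root in the Ulam-Harris tree, as sequences of labels. -/
def Ray : Type := ℕ → ℕ

/-- The metric `d(x, y) = 2 ^ (-|x ∧ y|)` for `x ≠ y`, where `|x ∧ y|` is the level of the last
common ancestor, that is, the first index at which the two label sequences differ. -/
noncomputable instance : MetricSpace Ray := PiNat.metricSpaceNatNat

theorem Ray.dist_eq (x y : ℕ → ℕ) (h : x ≠ y) :
    dist (show Ray from x) (show Ray from y) = (1 / 2 : ℝ) ^ PiNat.firstDiff x y :=
  PiNat.dist_eq_of_ne h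

/-- The Gromov boundary of the tree with offspring numbers `c`: the infinite paths all of whose
finite initial segments `PiNat.res ξ n = [ξ (n-1), ..., ξ 0]` are nodes of the tree. -/
def gromovBoundary (c : List ℕ → ℕ) : Set Ray :=
  {ξ | ∀ n : ℕ, IsNode c (PiNat.res (show ℕ → ℕ from ξ) n)}

/-- `X v`, for `v` ranging over all potential nodes, are i.i.d. random variables with law `θ`.
The Galton-Watson tree of the outcome `ω` is the tree with offspring numbers `fun v => X v ω`. -/
structure IsGaltonWatson {Ω : Type*} [MeasurableSpace Ω] (θ : PMF ℕ) (P : Measure Ω)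
    (X : List ℕ → Ω → ℕ) : Prop where
  measurable : ∀ v, Measurable (X v)
  law : ∀ v j, P (X v ⁻¹' {j}) = θ j
  indep : iIndepFun X P

/-- `N_r(A)`, the least number of sets of radius at most `r` (subsets of closed balls of radius `r`)
needed to cover `A`. -/
noncomputable def coverNumber {E : Type*} [MetricSpace E] (r : ℝ) (A : Set E) : ℕ∞ :=
  Metric.externalCoveringNumber r.toNNReal A

/-- `dim_A^φ F`: the infimum of the `s` for which there is `C` with
`N_r(F ∩ B(x, R)) ≤ C (R / r) ^ s` for all `x ∈ F` and `0 < r = R ^ (1 + φ R) < R < 1`. -/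
noncomputable def phiAssouadDim {E : Type*} [MetricSpace E] (φ : ℝ → ℝ) (F : Set E) : EReal :=
  sInf ((fun s : ℝ => (s : EReal)) '' {s : ℝ | ∃ C : ℝ, 0 < C ∧
    ∀ r R : ℝ, 0 < r → r = R ^ (1 + φ R) → r < R → R < 1 → ∀ x ∈ F,
      (coverNumber r (F ∩ Metric.closedBall x R) : ℝ≥0∞) ≤ ENNReal.ofReal (C * (R / r) ^ s)})

/-- `dim_A F`, the Assouad dimension: as above, for all `0 < r ≤ R < 1`. -/
noncomputable def assouadDim {E : Type*} [MetricSpace E] (F : Set E) : EReal :=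
  sInf ((fun s : ℝ => (s : EReal)) '' {s : ℝ | ∃ C : ℝ, 0 < C ∧
    ∀ r R : ℝ, 0 < r → r ≤ R → R < 1 → ∀ x ∈ F,
      (coverNumber r (F ∩ Metric.closedBall x R) : ℝ≥0∞) ≤ ENNReal.ofReal (C * (R / r) ^ s)})

/-- A dimension function: `φ` is positive, and `φ x` and `φ x * |log x|` are monotone (each in either
direction), on some interval `(0, δ)` with `0 < δ ≤ 1`. Values away from `0` are unrestricted. -/
def IsDimensionFunction (φ : ℝ → ℝ) : Prop :=
  ∃ δ : ℝ, 0 < δ ∧ δ ≤ 1 ∧ (∀ x ∈ Ioo 0 δ, 0 < φ x) ∧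
    (MonotoneOn φ (Ioo 0 δ) ∨ AntitoneOn φ (Ioo 0 δ)) ∧
    (MonotoneOn (fun x => φ x * |Real.log x|) (Ioo 0 δ) ∨
      AntitoneOn (fun x => φ x * |Real.log x|) (Ioo 0 δ))

/-! Let M ≥ 2 be the largest number charged by θ. Almost surely no node has more than M children, so
a ball of radius about 2^(-k) is covered by M^(n-k) balls of radius 2^(-n), and dim_A F ≤ log₂ M
(`assouadDim_le_logb`). Since dim_A^φ F ≤ dim_A F always holds, it remains to show dim_A^φ F ≥ log₂
M.

For this it is enough that, at arbitrarily high levels k, some node roots a complete M-ary tree of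
depth L ≈ (log k) / (2 log (M+1)) whose leaves all survive (`ae_frequently_fullTrees`). With R =
2^(-k) and r = R^(1+φ(R)) = 2^(-k-t), t = φ(R)k, the bound on φ gives ⌊t⌋ ≤ L, so at least M^⌊t⌋
sets of radius r are needed; as t → ∞, multiplicative constants do not affect the exponent
(`logb_le_phiAssouadDim`).

Such trees appear because a full tree of depth L has probability p ≥ ε^((M+1)^L) ≥ ε^√k, only
subexponentially small, while a surviving population grows exponentially. In terms of the generating
function f, the probability of reaching level k = 2j with no full tree rooted there is f^[2j](1-p) -
f^[2j](0). The first j iterations push 1-p below a fixed 1-u₀ < 1; the other j bring it to the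
extinction probability. So these probabilities tend to 0, and almost surely they do not all occur
from some level on. No independence between levels is needed. -/

/-! ### The branching property of the tree law. -/

/-- The offspring numbers of the subtree of descendants of the `i`-th child of the root. -/
def childTree (i : ℕ) (c : List ℕ → ℕ) : List ℕ → ℕ := fun v => c (v ++ [i])

/-- The trees all of whose subtrees at the children of the root lie in `E`. -/
def allChildren (E : Set (List ℕ → ℕ)) : Set (List ℕ → ℕ) :=
  {c | ∀ i < c [], childTree i c ∈ E}

/-- The law of the offspring numbers of a Galton-Watson tree. -/
noncomputable def treeLaw (θ : PMF ℕ) : Measure (List ℕ → ℕ) :=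
  Measure.infinitePi fun _ => θ.toMeasure

instance (θ : PMF ℕ) : IsProbabilityMeasure (treeLaw θ) := by
  unfold treeLaw; infer_instance

@[fun_prop]
theorem measurable_childTree (i : ℕ) : Measurable (childTree i) := by
  unfold childTree; fun_prop

theorem measurableSet_allChildren {E : Set (List ℕ → ℕ)} (hE : MeasurableSet E) :
    MeasurableSet (allChildren E) := by
  have : allChildren E = ⋂ i : ℕ, {c | i < c []}ᶜ ∪ childTree i ⁻¹' E := by
    ext c
    simp only [allChildren, mem_ofPred_eq, mem_iInter, mem_union, mem_compl_iff, mem_preimage]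
    exact forall_congr' fun i => by tauto
  rw [this]
  refine MeasurableSet.iInter fun i => MeasurableSet.union (MeasurableSet.compl ?_)
    (measurable_childTree i hE)
  exact measurableSet_lt measurable_const (measurable_pi_apply _)

theorem measurableSet_iterate_allChildren {E : Set (List ℕ → ℕ)} (hE : MeasurableSet E) (k : ℕ) :
    MeasurableSet (allChildren^[k] E) := by
  induction k with
  | zero => exact hE
  | succ k ih => rw [Function.iterate_succ_apply']; exact measurableSet_allChildren ih

theorem allChildren_mono : Monotone allChildren :=
  fun _ _ h _ hc i hi => h (hc i hi)

/-- The coordinate of an independent family of trees from which the offspring number of a node is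
read when the subtrees at the children of the root are prescribed by the family. -/
def splitNode (v : List ℕ) : ℕ × List ℕ := (v.getLast?.elim 0 Nat.succ, v.dropLast)

theorem splitNode_nil : splitNode [] = (0, []) := rfl

theorem splitNode_append (v : List ℕ) (i : ℕ) : splitNode (v ++ [i]) = (i + 1, v) := by
  simp [splitNode]

theorem splitNode_injective : Function.Injective splitNode := by
  intro v w h
  rcases List.eq_nil_or_concat v with rfl | ⟨v, i, rfl⟩ <;>
  rcases List.eq_nil_or_concat w with rfl | ⟨w, j, rfl⟩ <;>
  simp_all [splitNode_nil, splitNode_append]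

/-- The root is read from tree 0 of an independent family and the subtree at child i from tree i +
1. No coordinate is read twice, so the numbers obtained are again i.i.d. with law θ. -/
theorem treeLaw_eq_map (θ : PMF ℕ) : treeLaw θ =
    (Measure.infinitePi fun _ : ℕ => treeLaw θ).map
      (fun T v => T (splitNode v).1 (splitNode v).2) := by
  have h1 := Measure.infinitePi_map_curry_symm
    (fun (_ : ℕ) (_ : List ℕ) => θ.toMeasure)
  have h2 := Measure.map_infinitePi_infinitePi_of_inj
    (P := fun _ : ℕ × List ℕ => θ.toMeasure) splitNode_injective
  rw [← h1, Measure.map_map (by fun_prop) (by fun_prop)] at h2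
  exact h2.symm

/-- The children of the root carry independent trees with the law of the whole tree. -/
theorem treeLaw_root_eq_and_forall (θ : PMF ℕ) (j : ℕ) {E : Set (List ℕ → ℕ)}
    (hE : MeasurableSet E) :
    treeLaw θ {c | c [] = j ∧ ∀ i < j, childTree i c ∈ E} = θ j * treeLaw θ E ^ j := by
  have hroot : MeasurableSet {c : List ℕ → ℕ | c [] = j} :=
    measurableSet_eq_fun (measurable_pi_apply _) measurable_const
  have hall : MeasurableSet {c : List ℕ → ℕ | ∀ i < j, childTree i c ∈ E} := by
    have : {c : List ℕ → ℕ | ∀ i < j, childTree i c ∈ E}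
        = ⋂ i : ℕ, ⋂ _ : i < j, childTree i ⁻¹' E := by ext; simp
    rw [this]
    exact MeasurableSet.iInter fun i => MeasurableSet.iInter fun _ => measurable_childTree i hE
  conv_lhs => rw [treeLaw_eq_map]
  have hmeas : MeasurableSet {c : List ℕ → ℕ | c [] = j ∧ ∀ i < j, childTree i c ∈ E} :=
    hroot.inter hall
  rw [Measure.map_apply (by fun_prop) hmeas]
  let t : ℕ → Set (List ℕ → ℕ) := fun n => if n = 0 then {c | c [] = j} else E
  have hset : ((fun (T : ℕ → List ℕ → ℕ) v => T (splitNode v).1 (splitNode v).2) ⁻¹'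
      {c | c [] = j ∧ ∀ i < j, childTree i c ∈ E}) = Set.pi (Finset.range (j + 1)) t := by
    ext T
    have hchild (i : ℕ) :
        childTree i (fun v => T (splitNode v).1 (splitNode v).2) = T (i + 1) := by
      ext v; simp [childTree, splitNode_append]
    simp only [mem_preimage, mem_ofPred_eq, splitNode_nil, hchild, Set.mem_pi,
      Finset.coe_range, mem_Iio, t]
    constructor
    · rintro ⟨h0, h1⟩ n hn
      rcases n with _ | n
      · simpa using h0
      · simpa using h1 n (by omega)
    · intro h
      exact ⟨by simpa using h 0 (by omega), fun i hi => by simpa using h (i + 1) (by omega)⟩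
  rw [hset, Measure.infinitePi_pi _ (by
    intro n _; by_cases hn : n = 0 <;> simp only [t, hn, if_true, if_false, hroot, hE]),
    Finset.prod_range_succ']
  simp only [t, if_true, Nat.add_eq_zero_iff, one_ne_zero, and_false, if_false,
    Finset.prod_const, Finset.card_range]
  rw [mul_comm]
  congr 1
  have : {c : List ℕ → ℕ | c [] = j} = (fun c => c []) ⁻¹' {j} := rfl
  rw [this, ← Measure.map_apply (by fun_prop) (measurableSet_singleton j), treeLaw,
    Measure.infinitePi_map_eval, PMF.toMeasure_apply_singleton _ _ (measurableSet_singleton j)]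

theorem ae_treeLaw_apply_le {θ : PMF ℕ} {M : ℕ} (hM : ∀ j, M < j → θ j = 0) :
    ∀ᵐ c ∂treeLaw θ, ∀ v, c v ≤ M := by
  rw [ae_all_iff]
  intro v
  have h : ∀ᵐ j ∂θ.toMeasure, j ≤ M := by
    rw [ae_iff, PMF.toMeasure_apply_eq_zero_iff _ (by measurability)]
    rw [Set.disjoint_left]
    intro j hj hj'
    exact (PMF.mem_support_iff _ _).1 hj (hM j (by simpa using hj'))
  have hmap : (treeLaw θ).map (fun c => c v) = θ.toMeasure := by
    rw [treeLaw, Measure.infinitePi_map_eval]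
  rw [← hmap] at h
  exact ae_of_ae_map (measurable_pi_apply v).aemeasurable h

/-- The probability generating function of an offspring law supported on `{0, ..., N}`. -/
noncomputable def genFun (N : ℕ) (θ : PMF ℕ) (x : ℝ) : ℝ :=
  ∑ j ∈ Finset.range (N + 1), (θ j).toReal * x ^ j

/-- Condition on the number j of children of the root: their subtrees are independent copies, which
contributes θ_j P(E)^j. -/
theorem treeLaw_real_allChildren {N : ℕ} {θ : PMF ℕ} (hN : ∀ j, N < j → θ j = 0)
    {E : Set (List ℕ → ℕ)} (hE : MeasurableSet E) :
    (treeLaw θ).real (allChildren E) = genFun N θ ((treeLaw θ).real E) := by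
  have hae : allChildren E =ᵐ[treeLaw θ]
      ⋃ j ∈ Finset.range (N + 1), {c | c [] = j ∧ ∀ i < j, childTree i c ∈ E} := by
    filter_upwards [ae_treeLaw_apply_le hN] with c hc
    apply propext
    change c ∈ allChildren E ↔ c ∈ (⋃ j ∈ Finset.range (N + 1),
      {c : List ℕ → ℕ | c [] = j ∧ ∀ i < j, childTree i c ∈ E})
    simp only [allChildren, mem_ofPred_eq, mem_iUnion, Finset.mem_range, exists_prop]
    constructor
    · intro h
      exact ⟨c [], Nat.lt_succ_of_le (hc []), rfl, h⟩
    · rintro ⟨j, _, rfl, h⟩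
      exact h
  rw [measureReal_congr hae, measureReal_biUnion_finset]
  · unfold genFun
    refine Finset.sum_congr rfl fun j _ => ?_
    rw [measureReal_def, treeLaw_root_eq_and_forall θ j hE, ENNReal.toReal_mul,
      ENNReal.toReal_pow, measureReal_def]
  · intro a _ b _ hab
    refine Set.disjoint_left.2 ?_
    rintro c ⟨h1, _⟩ ⟨h2, _⟩
    exact hab (h1.symm.trans h2)
  · intro j _
    have : {c : List ℕ → ℕ | c [] = j ∧ ∀ i < j, childTree i c ∈ E}
        = (fun c => c []) ⁻¹' {j} ∩ allChildren E := by
      ext c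
      simp only [allChildren, mem_ofPred_eq, mem_inter_iff, mem_preimage, mem_singleton_iff]
      constructor <;> rintro ⟨rfl, h⟩ <;> exact ⟨rfl, h⟩
    rw [this]
    exact (measurable_pi_apply ([] : List ℕ) (measurableSet_singleton j)).inter
      (measurableSet_allChildren hE)

/-- `allChildren^[k] E` is the event that every node of level k has its subtree in `E`. For `E = ∅`
it is extinction by level k; for a complement it says that no node of level k has the desired
subtree. -/
theorem treeLaw_real_iterate_allChildren {N : ℕ} {θ : PMF ℕ} (hN : ∀ j, N < j → θ j = 0)
    {E : Set (List ℕ → ℕ)} (hE : MeasurableSet E) (k : ℕ) :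
    (treeLaw θ).real (allChildren^[k] E) = (genFun N θ)^[k] ((treeLaw θ).real E) := by
  induction k with
  | zero => rfl
  | succ k ih =>
    rw [Function.iterate_succ_apply', Function.iterate_succ_apply',
      treeLaw_real_allChildren hN (measurableSet_iterate_allChildren hE k), ih]

/-! ### Surviving trees and full trees. -/

/-- The trees with nodes on all levels. -/
def survivingTrees : Set (List ℕ → ℕ) := {c | ∀ k, c ∉ allChildren^[k] ∅}

theorem measurableSet_survivingTrees : MeasurableSet survivingTrees := by
  have : survivingTrees = ⋂ k, (allChildren^[k] ∅)ᶜ := by ext; simp [survivingTrees]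
  rw [this]
  exact MeasurableSet.iInter fun k =>
    (measurableSet_iterate_allChildren MeasurableSet.empty k).compl

/-- The trees that are `M`-ary up to level `L`, with descendants of all nodes of level `L` on all
levels. -/
def fullTrees (M : ℕ) : ℕ → Set (List ℕ → ℕ)
  | 0 => survivingTrees
  | L + 1 => {c | c [] = M ∧ ∀ i < M, childTree i c ∈ fullTrees M L}

theorem measurableSet_fullTrees (M L : ℕ) : MeasurableSet (fullTrees M L) := by
  induction L with
  | zero => exact measurableSet_survivingTrees
  | succ L ih =>
    have : fullTrees M (L + 1) = (fun c => c []) ⁻¹' {M} ∩ allChildren (fullTrees M L) := by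
      ext c
      simp only [fullTrees, allChildren, mem_ofPred_eq, mem_inter_iff, mem_preimage,
        mem_singleton_iff]
      constructor <;> rintro ⟨rfl, h⟩ <;> exact ⟨rfl, h⟩
    rw [this]
    exact (measurable_pi_apply ([] : List ℕ) (measurableSet_singleton M)).inter
      (measurableSet_allChildren ih)

/-- The probabilities satisfy p_(L+1) = θ_M p_L^M. Using (M+1)^L as exponent leaves room for the
extra factor, since 1 + M(M+1)^L ≤ (M+1)^(L+1). -/
theorem pow_le_treeLaw_real_fullTrees {θ : PMF ℕ} {M : ℕ} {ε : ℝ} (hε : 0 ≤ ε) (hε1 : ε ≤ 1)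
    (hs : ε ≤ (treeLaw θ).real survivingTrees) (hM : ε ≤ (θ M).toReal) (L : ℕ) :
    ε ^ (M + 1) ^ L ≤ (treeLaw θ).real (fullTrees M L) := by
  induction L with
  | zero => simpa [fullTrees] using hs
  | succ L ih =>
    have h : (treeLaw θ).real (fullTrees M (L + 1))
        = (θ M).toReal * (treeLaw θ).real (fullTrees M L) ^ M := by
      rw [measureReal_def, fullTrees, treeLaw_root_eq_and_forall θ M (measurableSet_fullTrees M L),
        ENNReal.toReal_mul, ENNReal.toReal_pow, measureReal_def]
    rw [h]
    calc ε ^ (M + 1) ^ (L + 1) ≤ ε ^ (1 + (M + 1) ^ L * M) := by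
          refine pow_le_pow_of_le_one hε hε1 ?_
          have : 1 ≤ (M + 1) ^ L := Nat.one_le_pow _ _ (by omega)
          rw [pow_succ]; nlinarith
      _ = ε * (ε ^ (M + 1) ^ L) ^ M := by rw [pow_add, pow_one, pow_mul]
      _ ≤ _ := by gcongr

theorem survives_mem_survivingTrees {c : List ℕ → ℕ} (h : Survives c) : c ∈ survivingTrees := by
  have key : ∀ (k : ℕ) (c : List ℕ → ℕ) (v : List ℕ), v.length = k → IsNode c v →
      c ∉ allChildren^[k] ∅ := by
    intro k
    induction k with
    | zero => intro c v _ _; simp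
    | succ k ih =>
      intro c v hv hc
      rcases List.eq_nil_or_concat v with rfl | ⟨v, i, rfl⟩
      · simp at hv
      have h2 : ∀ w, IsNode c (w ++ [i]) → i < c [] ∧ IsNode (childTree i c) w := by
        intro w
        induction w with
        | nil => intro h; exact ⟨h.2, trivial⟩
        | cons a w ihw => intro h; exact ⟨(ihw h.1).1, (ihw h.1).2, h.2⟩
      rw [List.concat_eq_append] at hc hv
      obtain ⟨h3, h4⟩ := h2 v hc
      rw [Function.iterate_succ_apply']
      exact fun hmem => ih _ v (by simpa using hv) h4 (hmem i h3)
  intro k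
  obtain ⟨v, hv, hk⟩ := h k
  exact key k c v hk hv

theorem monotone_iterate_allChildren_empty : Monotone fun k => allChildren^[k] ∅ := by
  refine monotone_nat_of_le_succ fun k => ?_
  rw [Function.iterate_succ_apply]
  exact allChildren_mono.iterate k (Set.empty_subset _)

/-- If all of the finitely many subtrees at the root's children died out, they would all be extinct
by a common level, and the whole tree one level later. -/
theorem exists_child_mem_survivingTrees {c : List ℕ → ℕ} (h : c ∈ survivingTrees) :
    ∃ i < c [], childTree i c ∈ survivingTrees := by
  by_contra! hcon
  have : ∀ i, ∃ k, i < c [] → childTree i c ∈ allChildren^[k] ∅ := by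
    intro i
    by_cases hi : i < c []
    · have := hcon i hi
      simp only [survivingTrees, mem_ofPred_eq, not_forall, not_not] at this
      exact this.imp fun k hk _ => hk
    · exact ⟨0, fun h => absurd h hi⟩
  choose k hk using this
  refine h ((Finset.range (c [])).sup k + 1) ?_
  rw [Function.iterate_succ_apply']
  intro i hi
  exact monotone_iterate_allChildren_empty
    (Finset.le_sup (f := k) (Finset.mem_range.2 hi)) (hk i hi)

/-! ### Iteration of the generating function. -/

theorem sum_toReal_eq_one {N : ℕ} {θ : PMF ℕ} (hN : ∀ j, N < j → θ j = 0) :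
    ∑ j ∈ Finset.range (N + 1), (θ j).toReal = 1 := by
  have h := θ.tsum_coe
  rw [tsum_eq_sum (s := Finset.range (N + 1))
    (fun j hj => hN j (by simpa using hj))] at h
  rw [← ENNReal.toReal_sum fun j _ => θ.apply_ne_top j, h, ENNReal.toReal_one]

theorem genFun_one {N : ℕ} {θ : PMF ℕ} (hN : ∀ j, N < j → θ j = 0) : genFun N θ 1 = 1 := by
  simpa [genFun] using sum_toReal_eq_one hN

theorem genFun_nonneg (N : ℕ) (θ : PMF ℕ) {x : ℝ} (hx : 0 ≤ x) : 0 ≤ genFun N θ x :=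
  Finset.sum_nonneg fun j _ => by positivity

theorem genFun_le_genFun (N : ℕ) (θ : PMF ℕ) {x y : ℝ} (hx : 0 ≤ x) (hxy : x ≤ y) :
    genFun N θ x ≤ genFun N θ y :=
  Finset.sum_le_sum fun j _ => by gcongr

theorem continuous_genFun (N : ℕ) (θ : PMF ℕ) : Continuous (genFun N θ) := by
  unfold genFun; fun_prop

theorem genFun_iterate_nonneg (N : ℕ) (θ : PMF ℕ) {x : ℝ} (hx : 0 ≤ x) (k : ℕ) :
    0 ≤ (genFun N θ)^[k] x := by
  induction k with
  | zero => exact hx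
  | succ k ih => rw [Function.iterate_succ_apply']; exact genFun_nonneg N θ ih

theorem genFun_iterate_le (N : ℕ) (θ : PMF ℕ) {x y : ℝ} (hx : 0 ≤ x) (hxy : x ≤ y) (k : ℕ) :
    (genFun N θ)^[k] x ≤ (genFun N θ)^[k] y := by
  induction k with
  | zero => exact hxy
  | succ k ih =>
    rw [Function.iterate_succ_apply', Function.iterate_succ_apply']
    exact genFun_le_genFun N θ (genFun_iterate_nonneg N θ hx k) ih

/-- Linear growth of `1 - f` near the fixed point `1` of the generating function `f`. -/
theorem exists_genFun_one_sub_le {N : ℕ} {θ : PMF ℕ} (hN : ∀ j, N < j → θ j = 0)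
    (hm : 1 < ∑ k ∈ Finset.Icc 1 N, (θ k).toReal * (k : ℝ)) :
    ∃ m u₀ : ℝ, 1 < m ∧ 0 < u₀ ∧ u₀ < 1 ∧
      ∀ u, 0 ≤ u → u ≤ u₀ → genFun N θ (1 - u) ≤ 1 - m * u := by
  set μ := ∑ k ∈ Finset.Icc 1 N, (θ k).toReal * (k : ℝ) with hμ
  have hμ' : μ = ∑ k ∈ Finset.range (N + 1), (θ k).toReal * (k : ℝ) := by
    rw [hμ, Finset.range_eq_Ico, Finset.sum_eq_sum_Ico_succ_bot (by omega)]
    simp only [Nat.cast_zero, mul_zero, zero_add]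
    rfl
  have hd : HasDerivAt (genFun N θ) μ 1 := by
    have : HasDerivAt (fun x : ℝ => ∑ j ∈ Finset.range (N + 1), (θ j).toReal * x ^ j)
        (∑ j ∈ Finset.range (N + 1), (θ j).toReal * ((j : ℝ) * 1 ^ (j - 1))) 1 :=
      HasDerivAt.fun_sum fun j _ => (hasDerivAt_pow j (1 : ℝ)).const_mul _
    rw [hμ']
    simp only [one_pow, mul_one] at this
    exact this
  have hg : HasDerivAt (fun u => genFun N θ (1 - u)) (-μ) 0 := by
    have h1 : HasDerivAt (fun u : ℝ => 1 - u) (-1) 0 := by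
      simpa using (hasDerivAt_id (0 : ℝ)).const_sub 1
    have h2 : HasDerivAt (genFun N θ) μ (1 - 0) := by simpa using hd
    have h3 := h2.comp (0 : ℝ) h1
    rw [mul_neg_one] at h3
    exact h3
  -- Any slope strictly between 1 and the mean μ would do; the midpoint (1 + μ)/2 is taken.
  have hslope := (hasDerivAt_iff_tendsto_slope.1 hg).eventually
    (gt_mem_nhds (show -μ < -((1 + μ) / 2) by linarith))
  rw [eventually_nhdsWithin_iff, Metric.eventually_nhds_iff] at hslope
  obtain ⟨δ, hδ, hs⟩ := hslope
  refine ⟨(1 + μ) / 2, min (δ / 2) (1 / 2), by linarith, by positivity,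
    (min_le_right _ _).trans_lt (by norm_num), fun u hu hu' => ?_⟩
  rcases hu.eq_or_lt with rfl | hpos
  · simp [genFun_one hN]
  have h := hs (y := u) (by
    rw [dist_zero_right, Real.norm_of_nonneg hu]
    linarith [hu'.trans (min_le_left _ _)]) hpos.ne'
  rw [slope_def_field, sub_zero, sub_zero, genFun_one hN, div_lt_iff₀ hpos] at h
  linarith

/-- Each iteration multiplies the gap below 1 by at least m until it reaches u₀, and from then on
the gap stays at least u₀. -/
theorem genFun_iterate_one_sub_le {N : ℕ} {θ : PMF ℕ} {m u₀ : ℝ} (hm : 1 < m) (hu₀ : 0 < u₀)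
    (h : ∀ u, 0 ≤ u → u ≤ u₀ → genFun N θ (1 - u) ≤ 1 - m * u)
    {p : ℝ} (hp : 0 ≤ p) (hp1 : p ≤ 1) (k : ℕ) :
    (genFun N θ)^[k] (1 - p) ≤ 1 - min (m ^ k * p) u₀ := by
  induction k with
  | zero =>
    rw [Function.iterate_zero_apply, pow_zero, one_mul]
    linarith [min_le_left p u₀]
  | succ k ih =>
    rw [Function.iterate_succ_apply']
    have h0 : 0 ≤ min (m ^ k * p) u₀ := le_min (by positivity) hu₀.le
    calc genFun N θ ((genFun N θ)^[k] (1 - p)) ≤ genFun N θ (1 - min (m ^ k * p) u₀) :=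
          genFun_le_genFun N θ (genFun_iterate_nonneg N θ (by linarith) k) ih
      _ ≤ 1 - m * min (m ^ k * p) u₀ := h _ h0 (min_le_right _ _)
      _ ≤ 1 - min (m ^ (k + 1) * p) u₀ := by
          rcases min_choice (m ^ k * p) u₀ with h' | h' <;> rw [h']
          · have : m ^ (k + 1) * p = m * (m ^ k * p) := by ring
            linarith [min_le_left (m ^ (k + 1) * p) u₀]
          · nlinarith [min_le_right (m ^ (k + 1) * p) u₀]

theorem strictConvexOn_genFun {N M : ℕ} {θ : PMF ℕ} (hM : 2 ≤ M) (hMN : M ≤ N) (hθ : θ M ≠ 0) :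
    StrictConvexOn ℝ (Ici 0) (genFun N θ) := by
  have hpos : 0 < (θ M).toReal := ENNReal.toReal_pos hθ (θ.apply_ne_top M)
  have hconv : ConvexOn ℝ (Ici (0 : ℝ))
      (fun x => ∑ j ∈ (Finset.range (N + 1)).erase M, (θ j).toReal * x ^ j) := by
    have := Finset.sum_induction (s := (Finset.range (N + 1)).erase M)
      (fun j (x : ℝ) => (θ j).toReal * x ^ j) (ConvexOn ℝ (Ici (0 : ℝ)))
      (fun _ _ ha hb => ha.add hb) (convexOn_const 0 (convex_Ici 0))
      (fun j _ => (convexOn_pow j).smul ENNReal.toReal_nonneg)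
    convert this using 1
    ext x
    simp
  have hstrict : StrictConvexOn ℝ (Ici (0 : ℝ)) (fun x => (θ M).toReal * x ^ M) := by
    refine ⟨convex_Ici 0, fun x hx y hy hxy a b ha hb hab => ?_⟩
    have := (strictConvexOn_pow hM).2 hx hy hxy ha hb hab
    have h2 := mul_lt_mul_of_pos_left this hpos
    simp only [smul_eq_mul] at h2 ⊢
    linarith
  have : genFun N θ = (fun x => ∑ j ∈ (Finset.range (N + 1)).erase M, (θ j).toReal * x ^ j)
      + fun x => (θ M).toReal * x ^ M := by
    ext x
    simp only [genFun, Pi.add_apply]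
    rw [Finset.sum_erase_add _ _ (Finset.mem_range.2 (by omega))]
  rw [this]
  exact hconv.add_strictConvexOn hstrict

/-- The orbits of y and 0 are monotone and converge to fixed points a ≥ b below 1. If b < a, then a
is a proper convex combination of the fixed points b and 1, and strict convexity gives f(a) < a. -/
theorem tendsto_genFun_iterate_sub {N M : ℕ} {θ : PMF ℕ} (hN : ∀ j, N < j → θ j = 0)
    (hM : 2 ≤ M) (hMN : M ≤ N) (hθ : θ M ≠ 0) {y : ℝ} (hy0 : 0 ≤ y) (hy1 : y < 1)
    (hy : genFun N θ y ≤ y) :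
    Tendsto (fun k => (genFun N θ)^[k] y - (genFun N θ)^[k] 0) atTop (𝓝 0) := by
  set f := genFun N θ with hf
  have hanti : Antitone fun k => f^[k] y := antitone_nat_of_succ_le fun k => by
    rw [Function.iterate_succ_apply]
    exact genFun_iterate_le N θ (genFun_nonneg N θ hy0) hy k
  have hmono : Monotone fun k => f^[k] 0 := monotone_nat_of_le_succ fun k => by
    rw [Function.iterate_succ_apply]
    exact genFun_iterate_le N θ le_rfl (genFun_nonneg N θ le_rfl) k
  have hle (k : ℕ) : f^[k] 0 ≤ f^[k] y := genFun_iterate_le N θ le_rfl hy0 k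
  have hley (k : ℕ) : f^[k] y ≤ y := by simpa using hanti (Nat.zero_le k)
  have ha := tendsto_atTop_ciInf hanti
    ⟨0, by rintro _ ⟨k, rfl⟩; exact genFun_iterate_nonneg N θ hy0 k⟩
  have hb := tendsto_atTop_ciSup hmono ⟨y, by rintro _ ⟨k, rfl⟩; exact (hle k).trans (hley k)⟩
  set a := ⨅ k, f^[k] y
  set b := ⨆ k, f^[k] 0
  have hfa := isFixedPt_of_tendsto_iterate ha (continuous_genFun N θ).continuousAt
  have hfb := isFixedPt_of_tendsto_iterate hb (continuous_genFun N θ).continuousAt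
  have hba : b ≤ a := le_of_tendsto_of_tendsto' hb ha hle
  have hay : a ≤ y := le_of_tendsto' ha hley
  have hb0 : 0 ≤ b := ge_of_tendsto' hb fun k => genFun_iterate_nonneg N θ le_rfl k
  have hab : a = b := by
    by_contra hne
    have hlt : b < a := lt_of_le_of_ne hba (Ne.symm hne)
    have h1b : 0 < 1 - b := by linarith
    have hsum : (1 - a) / (1 - b) + (a - b) / (1 - b) = 1 := by field_simp; ring
    have h := (strictConvexOn_genFun hM hMN hθ).2 (mem_Ici.2 hb0)
      (mem_Ici.2 (zero_le_one' ℝ)) (by linarith) (div_pos (by linarith) h1b)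
      (div_pos (by linarith) h1b) hsum
    simp only [smul_eq_mul, genFun_one hN] at h
    rw [show genFun N θ b = b from hfb,
      show (1 - a) / (1 - b) * b + (a - b) / (1 - b) * 1 = a by field_simp; ring,
      show genFun N θ a = a from hfa] at h
    exact lt_irrefl _ h
  simpa [hab] using ha.sub hb

/-- Starting from 0, at gap 1, the iterates never exceed 1 - u₀, so extinction has probability at
most 1 - u₀. -/
theorem treeLaw_real_survivingTrees_pos {N : ℕ} {θ : PMF ℕ}
    (hN : ∀ j, N < j → θ j = 0)
    (hm : 1 < ∑ k ∈ Finset.Icc 1 N, (θ k).toReal * (k : ℝ)) :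
    0 < (treeLaw θ).real survivingTrees := by
  obtain ⟨m, u₀, hm1, hu₀, hu₁, h⟩ := exists_genFun_one_sub_le hN hm
  have hk (k : ℕ) : (treeLaw θ).real (allChildren^[k] ∅) ≤ 1 - u₀ := by
    rw [treeLaw_real_iterate_allChildren hN MeasurableSet.empty, measureReal_empty]
    have := genFun_iterate_one_sub_le hm1 hu₀ h zero_le_one le_rfl k
    rw [sub_self, mul_one, min_eq_right (hu₁.le.trans (one_le_pow₀ hm1.le))] at this
    exact this
  have hlim : Tendsto (fun k => (treeLaw θ).real (allChildren^[k] ∅)) atTop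
      (𝓝 ((treeLaw θ).real (⋃ k, allChildren^[k] ∅))) :=
    (ENNReal.tendsto_toReal (measure_ne_top _ _)).comp
      (tendsto_measure_iUnion_atTop monotone_iterate_allChildren_empty)
  have hle := le_of_tendsto' hlim hk
  have hcompl : survivingTrees = (⋃ k, allChildren^[k] ∅)ᶜ := by
    ext; simp [survivingTrees]
  rw [hcompl, measureReal_compl (MeasurableSet.iUnion fun k =>
    measurableSet_iterate_allChildren MeasurableSet.empty k), probReal_univ]
  linarith

/-! ### Full subtrees on arbitrarily high levels. -/

/-- The depth of the full subtrees to be found on level `k`. -/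
def fullDepth (M k : ℕ) : ℕ := Nat.log (M + 1) (Nat.sqrt k)

theorem one_le_pow_mul_pow {m ε : ℝ} (hm : 1 < m) (hε : 0 < ε) :
    ∃ j₀ : ℕ, ∀ j e : ℕ, j₀ ≤ j → e ≤ Nat.sqrt (2 * j) → 1 ≤ m ^ j * ε ^ e := by
  obtain ⟨a, ha⟩ := pow_unbounded_of_one_lt (1 / ε) hm
  -- With m^a > 1/ε it suffices that a·e ≤ j; as e² ≤ 2j, this holds once j ≥ 2a².
  refine ⟨2 * a ^ 2, fun j e hj he => ?_⟩
  have hae : a * e ≤ j := by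
    have h1 : e * e ≤ 2 * j := Nat.le_sqrt.1 he
    by_contra! hlt
    have : j * j < (a * e) * (a * e) := Nat.mul_self_lt_mul_self hlt
    nlinarith
  have h1 : 1 ≤ m ^ a * ε := by
    rw [div_lt_iff₀ hε] at ha; exact ha.le
  calc (1 : ℝ) ≤ (m ^ a * ε) ^ e := one_le_pow₀ h1
    _ = m ^ (a * e) * ε ^ e := by rw [mul_pow, ← pow_mul]
    _ ≤ m ^ j * ε ^ e := by gcongr; exact hm.le

/-- Almost surely on survival, there are full subtrees of logarithmic depth on arbitrarily high
levels. -/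
theorem ae_frequently_fullTrees {N M : ℕ} {θ : PMF ℕ} (hN : ∀ j, N < j → θ j = 0)
    (hm : 1 < ∑ k ∈ Finset.Icc 1 N, (θ k).toReal * (k : ℝ))
    (hM : 2 ≤ M) (hMN : M ≤ N) (hθ : θ M ≠ 0) :
    ∀ᵐ c ∂treeLaw θ, c ∈ survivingTrees → ∀ n, ∃ k, n ≤ k ∧
      c ∉ allChildren^[k] (fullTrees M (fullDepth M k))ᶜ := by
  obtain ⟨m, u₀, hm1, hu₀, hu₁, h⟩ := exists_genFun_one_sub_le hN hm
  have hpos : 0 < (θ M).toReal := ENNReal.toReal_pos hθ (θ.apply_ne_top M)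
  have hsurv := treeLaw_real_survivingTrees_pos hN hm
  set ε := min ((treeLaw θ).real survivingTrees) (θ M).toReal with hε
  have hε0 : 0 < ε := lt_min hsurv hpos
  have hε1 : ε ≤ 1 := (min_le_left _ _).trans measureReal_le_one
  obtain ⟨j₀, hj₀⟩ := one_le_pow_mul_pow hm1 hε0
  set f := genFun N θ with hf
  have hfix : genFun N θ (1 - u₀) ≤ 1 - u₀ := (h u₀ hu₀.le le_rfl).trans (by nlinarith)
  have hlim := tendsto_genFun_iterate_sub hN hM hMN hθ (y := 1 - u₀) (by linarith) (by linarith)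
    hfix
  -- Level 2j is reached, but no node there roots a full tree of the prescribed depth. Even levels
  -- allow the iterations to be split into two halves.
  let B : ℕ → Set (List ℕ → ℕ) := fun j =>
    allChildren^[2 * j] (fullTrees M (fullDepth M (2 * j)))ᶜ \ allChildren^[2 * j] ∅
  have hB (j : ℕ) (hj : max j₀ 1 ≤ j) :
      (treeLaw θ).real (B j) ≤ f^[j] (1 - u₀) - f^[j] 0 := by
    set p := (treeLaw θ).real (fullTrees M (fullDepth M (2 * j))) with hp
    have hp1 : p ≤ 1 := measureReal_le_one
    have hsub : allChildren^[2 * j] ∅ ⊆ allChildren^[2 * j] (fullTrees M (fullDepth M (2 * j)))ᶜ :=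
      allChildren_mono.iterate _ (Set.empty_subset _)
    have hmf := measurableSet_fullTrees M (fullDepth M (2 * j))
    rw [measureReal_sdiff hsub (measurableSet_iterate_allChildren MeasurableSet.empty _),
      treeLaw_real_iterate_allChildren hN MeasurableSet.empty,
      treeLaw_real_iterate_allChildren hN hmf.compl, measureReal_compl hmf, probReal_univ,
      measureReal_empty, ← hp, ← hf]
    have hpe : ε ^ (M + 1) ^ fullDepth M (2 * j) ≤ p :=
      pow_le_treeLaw_real_fullTrees hε0.le hε1 (min_le_left _ _) (min_le_right _ _) _
    have he : (M + 1) ^ fullDepth M (2 * j) ≤ Nat.sqrt (2 * j) := by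
      refine Nat.pow_log_le_self _ ?_
      rw [Ne, Nat.sqrt_eq_zero]
      have := (le_max_right j₀ 1).trans hj
      omega
    have h1 : f^[j] (1 - p) ≤ 1 - u₀ := by
      have hit := genFun_iterate_one_sub_le hm1 hu₀ h (hp ▸ measureReal_nonneg) hp1 j
      have hbig : u₀ ≤ m ^ j * p := by
        calc u₀ ≤ 1 := hu₁.le
          _ ≤ m ^ j * ε ^ (M + 1) ^ fullDepth M (2 * j) :=
            hj₀ j _ ((le_max_left j₀ 1).trans hj) he
          _ ≤ m ^ j * p := by gcongr
      rwa [min_eq_right hbig] at hit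
    have h2 : f^[2 * j] (1 - p) ≤ f^[j] (1 - u₀) := by
      rw [two_mul, Function.iterate_add_apply]
      exact genFun_iterate_le N θ (genFun_iterate_nonneg N θ (by linarith) _) h1 _
    have h3 : f^[j] 0 ≤ f^[2 * j] 0 := by
      rw [two_mul, Function.iterate_add_apply]
      exact genFun_iterate_le N θ le_rfl (genFun_iterate_nonneg N θ le_rfl _) _
    linarith
  have hnull (n : ℕ) : treeLaw θ (⋂ j, ⋂ _ : n ≤ j, B j) = 0 := by
    -- The intersection lies in every single `B j` with `n ≤ j`, and the probabilities of these tend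
    -- to 0.
    have : (treeLaw θ).real (⋂ j, ⋂ _ : n ≤ j, B j) ≤ 0 := by
      refine ge_of_tendsto hlim ?_
      filter_upwards [eventually_ge_atTop (max j₀ 1), eventually_ge_atTop n] with j hj hnj
      exact (measureReal_mono (biInter_subset_of_mem hnj)).trans (hB j hj)
    rw [← measureReal_eq_zero_iff]
    exact le_antisymm this measureReal_nonneg
  have hae : ∀ᵐ c ∂treeLaw θ, ∀ n, c ∉ ⋂ j, ⋂ _ : n ≤ j, B j :=
    ae_all_iff.2 fun n => measure_eq_zero_iff_ae_notMem.1 (hnull n)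
  filter_upwards [hae] with c hc hs n
  have := hc n
  simp only [mem_iInter, not_forall] at this
  obtain ⟨j, hnj, hj⟩ := this
  exact ⟨2 * j, by omega, fun hmem => hj ⟨hmem, hs _⟩⟩

/-! ### Boundary points through a full subtree. -/

/-- The label sequence with first label `i` and remaining labels `ξ`. -/
def consRay (i : ℕ) (ξ : ℕ → ℕ) : ℕ → ℕ
  | 0 => i
  | n + 1 => ξ n

theorem isNode_append_singleton {c : List ℕ → ℕ} {i : ℕ} (hi : i < c []) {v : List ℕ}
    (hv : IsNode (childTree i c) v) : IsNode c (v ++ [i]) := by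
  induction v with
  | nil => exact ⟨trivial, hi⟩
  | cons a v ih => exact ⟨ih hv.1, hv.2⟩

theorem res_consRay (i : ℕ) (ξ : ℕ → ℕ) (n : ℕ) :
    PiNat.res (consRay i ξ) (n + 1) = PiNat.res ξ n ++ [i] := by
  induction n with
  | zero => rfl
  | succ n ih => rw [PiNat.res_succ, ih, PiNat.res_succ]; rfl

theorem consRay_mem_gromovBoundary {c : List ℕ → ℕ} {i : ℕ} (hi : i < c []) {ξ : Ray}
    (hξ : ξ ∈ gromovBoundary (childTree i c)) : consRay i ξ ∈ gromovBoundary c := by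
  rintro (_ | n)
  · trivial
  · exact res_consRay i ξ n ▸ isNode_append_singleton hi (hξ n)

theorem gromovBoundary_nonempty {c : List ℕ → ℕ} (hc : c ∈ survivingTrees) :
    (gromovBoundary c).Nonempty := by
  have h (t : survivingTrees) : ∃ i < t.1 [], childTree i t.1 ∈ survivingTrees :=
    exists_child_mem_survivingTrees t.2
  choose g hg hgs using h
  -- Moving to a surviving child at each step; `T n` is the subtree at the node reached on level n.
  let T : ℕ → survivingTrees := fun n =>
    Nat.rec ⟨c, hc⟩ (fun _ t => ⟨childTree (g t) t.1, hgs t⟩) n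
  let ξ : ℕ → ℕ := fun n => g (T n)
  have hT (n : ℕ) : (T n).1 = fun w => c (w ++ PiNat.res ξ n) := by
    induction n with
    | zero => ext w; simp [T]
    | succ n ih =>
      ext w
      calc (T n).1 (w ++ [g (T n)]) = c ((w ++ [g (T n)]) ++ PiNat.res ξ n) := congrFun ih _
        _ = c (w ++ PiNat.res ξ (n + 1)) := by rw [List.append_assoc]; rfl
  refine ⟨ξ, fun n => ?_⟩
  induction n with
  | zero => trivial
  | succ n ih =>
    refine ⟨ih, ?_⟩
    have := hg (T n)
    rwa [hT n] at this

theorem exists_mem_gromovBoundary_of_fullTrees {M L : ℕ} {c : List ℕ → ℕ}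
    (hc : c ∈ fullTrees M L) (w : ℕ → ℕ) (hw : ∀ i < L, w i < M) :
    ∃ ξ ∈ gromovBoundary c, ∀ i < L, ξ i = w i := by
  induction L generalizing c w with
  | zero =>
    obtain ⟨ξ, hξ⟩ := gromovBoundary_nonempty hc
    exact ⟨ξ, hξ, by simp⟩
  | succ L ih =>
    obtain ⟨hcM, hch⟩ := hc
    have h0 := hw 0 (by omega)
    obtain ⟨ξ, hξ, h⟩ := ih (hch (w 0) h0) (fun n => w (n + 1)) fun i hi => hw _ (by omega)
    refine ⟨consRay (w 0) ξ, consRay_mem_gromovBoundary (hcM ▸ h0) hξ, ?_⟩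
    rintro (_ | i) hi
    · rfl
    · exact h i (by omega)

/-- The prefix `p` is the address of a level-k node rooting a full tree: every M-ary word of length
L continues it, and survival of the leaves extends the result to an infinite path. -/
theorem exists_prefix_of_notMem_iterate_allChildren {M L k : ℕ} {c : List ℕ → ℕ}
    (hc : c ∉ allChildren^[k] (fullTrees M L)ᶜ) :
    ∃ p : ℕ → ℕ, ∀ w : ℕ → ℕ, (∀ i < L, w i < M) →
      ∃ ξ ∈ gromovBoundary c, (∀ i < k, ξ i = p i) ∧ ∀ i < L, ξ (k + i) = w i := by
  induction k generalizing c with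
  | zero =>
    refine ⟨0, fun w hw => ?_⟩
    obtain ⟨ξ, hξ, h⟩ := exists_mem_gromovBoundary_of_fullTrees (not_not.1 hc) w hw
    exact ⟨ξ, hξ, by simp, by simpa using h⟩
  | succ k ih =>
    rw [Function.iterate_succ_apply'] at hc
    change ¬ ∀ i < c [], _ at hc
    push Not at hc
    obtain ⟨i, hi, hci⟩ := hc
    obtain ⟨p, hp⟩ := ih hci
    refine ⟨consRay i p, fun w hw => ?_⟩
    obtain ⟨ξ, hξ, h1, h2⟩ := hp w hw
    refine ⟨consRay i ξ, consRay_mem_gromovBoundary hi hξ, ?_, fun j hj => ?_⟩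
    · rintro (_ | j) hj
      · rfl
      · exact h1 j (by omega)
    · rw [show k + 1 + j = (k + j) + 1 by omega]
      exact h2 j hj

/-! ### Covering numbers in the ultrametric space of rays. -/

theorem Ray.dist_le_iff (x y : Ray) (n : ℕ) :
    dist x y ≤ (1 / 2 : ℝ) ^ n ↔ ∀ i < n, x i = y i :=
  PiNat.mem_cylinder_iff_dist_le.symm

/-- Nonzero distances are powers of 1/2, so a distance below 2^(1-n) is at most 2^(-n). -/
theorem Ray.forall_eq_of_dist_lt {x y : Ray} {n : ℕ} (h : dist x y < 2 * (1 / 2 : ℝ) ^ n) :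
    ∀ i < n, x i = y i := by
  by_cases hxy : x = y
  · simp [hxy]
  rw [Ray.dist_eq x y hxy] at h
  intro i hi
  refine PiNat.apply_eq_of_lt_firstDiff (hi.trans_le ?_)
  by_contra! hlt
  have : (1 / 2 : ℝ) ^ (n - 1) ≤ (1 / 2 : ℝ) ^ PiNat.firstDiff x y :=
    pow_le_pow_of_le_one (by norm_num) (by norm_num) (by omega)
  obtain ⟨n, rfl⟩ : ∃ m, n = m + 1 := ⟨n - 1, by omega⟩
  rw [pow_succ] at h
  simp only [Nat.add_sub_cancel] at this
  linarith

theorem Ray.dist_le_max (x y z : Ray) : dist x z ≤ max (dist x y) (dist y z) :=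
  PiNat.dist_triangle_nonarch x y z

/-- The M^ℓ words of length ℓ give points in one ball of radius 2^(-k) at mutual distances at least
2·2^(-(k+ℓ)) > r. By the ultrametric inequality a ball of radius r contains at most one of them,
wherever its centre lies. -/
theorem pow_le_coverNumber {F : Set Ray} {M L k ℓ : ℕ} (hM : 0 < M) (hℓ : ℓ ≤ L) {p : ℕ → ℕ}
    (hF : ∀ w : ℕ → ℕ, (∀ i < L, w i < M) →
      ∃ ξ ∈ F, (∀ i < k, ξ i = p i) ∧ ∀ i < L, ξ (k + i) = w i)
    {r : ℝ} (hr0 : 0 ≤ r) (hr : r < 2 * (1 / 2) ^ (k + ℓ)) :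
    ∃ x ∈ F, ((M ^ ℓ : ℕ) : ℕ∞) ≤ coverNumber r (F ∩ Metric.closedBall x ((1 / 2) ^ k)) := by
  have hF' (w : Fin ℓ → Fin M) : ∃ ξ ∈ F, (∀ i < k, ξ i = p i) ∧
      ∀ i : Fin ℓ, ξ (k + i) = w i := by
    obtain ⟨ξ, h1, h2, h3⟩ := hF (fun i => if h : i < ℓ then w ⟨i, h⟩ else 0) fun i _ => by
      split_ifs
      · exact (w _).2
      · exact hM
    exact ⟨ξ, h1, h2, fun i => by rw [h3 i (i.2.trans_le hℓ)]; simp⟩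
  choose ξ hξF hξp hξw using hF'
  let w₀ : Fin ℓ → Fin M := fun _ => ⟨0, hM⟩
  refine ⟨ξ w₀, hξF w₀, ?_⟩
  unfold coverNumber Metric.externalCoveringNumber
  refine le_iInf₂ fun C hC => ?_
  have hy (w : Fin ℓ → Fin M) : ∃ y ∈ C, dist (ξ w) y ≤ r := by
    obtain ⟨y, hyC, hy⟩ := hC (x := ξ w) ⟨hξF w, (Ray.dist_le_iff _ _ _).2 fun i hi => by
      rw [hξp w i hi, hξp w₀ i hi]⟩
    refine ⟨y, hyC, ?_⟩
    change edist (ξ w) y ≤ ((r.toNNReal : ℝ≥0) : ℝ≥0∞) at hy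
    rwa [edist_dist, ← ENNReal.ofReal, ENNReal.ofReal_le_ofReal_iff hr0] at hy
  choose y hyC hy using hy
  have hinj : Function.Injective y := by
    intro w w' hww
    have hd : dist (ξ w) (ξ w') < 2 * (1 / 2 : ℝ) ^ (k + ℓ) := by
      refine ((Ray.dist_le_max (ξ w) (y w) (ξ w')).trans (max_le (hy w) ?_)).trans_lt hr
      rw [hww, dist_comm]
      exact hy w'
    ext i
    rw [← hξw, ← hξw]
    exact Ray.forall_eq_of_dist_lt hd _ (by have := i.2; omega)
  calc ((M ^ ℓ : ℕ) : ℕ∞) = ENat.card (Fin ℓ → Fin M) := by simp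
    _ ≤ (range y).encard := hinj.encard_range
    _ ≤ C.encard := encard_le_encard (range_subset_iff.2 hyC)

theorem coverNumber_le_pow {F : Set Ray} {M k n : ℕ} (hF : ∀ ξ ∈ F, ∀ i, ξ i < M) (x : Ray)
    {r R : ℝ} (hr : (1 / 2) ^ n ≤ r) (hR : R < 2 * (1 / 2) ^ k) :
    coverNumber r (F ∩ Metric.closedBall x R) ≤ ((M ^ (n - k) : ℕ) : ℕ∞) := by
  -- One centre for each word in positions k, ..., n-1, preceded by the labels of `x` and padded
  -- with 0. The centres need not lie in `F`.
  let y : (Fin (n - k) → Fin M) → Ray := fun w i =>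
    if i < k then x i else if h : i - k < n - k then w ⟨i - k, h⟩ else 0
  have hcover : Metric.IsCover r.toNNReal (F ∩ Metric.closedBall x R) (range y) := by
    rintro ξ ⟨hξF, hξ⟩
    have hξx := Ray.forall_eq_of_dist_lt ((Metric.mem_closedBall.1 hξ).trans_lt hR)
    refine ⟨_, ⟨fun i => ⟨ξ (k + i), hF ξ hξF _⟩, rfl⟩, ?_⟩
    change edist ξ _ ≤ ((r.toNNReal : ℝ≥0) : ℝ≥0∞)
    rw [edist_dist, ← ENNReal.ofReal]
    refine ENNReal.ofReal_le_ofReal (((Ray.dist_le_iff _ _ _).2 fun i hi => ?_).trans hr)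
    by_cases hik : i < k
    · simp [y, hik, hξx i hik]
    · have : i - k < n - k := by omega
      simp [y, hik, this, show k + (i - k) = i by omega]
  calc coverNumber r (F ∩ Metric.closedBall x R) ≤ (range y).encard :=
        hcover.externalCoveringNumber_le_encard
    _ ≤ (univ : Set (Fin (n - k) → Fin M)).encard := by
        rw [← image_univ]; exact encard_image_le _ _
    _ = ((M ^ (n - k) : ℕ) : ℕ∞) := by simp

/-! ### Upper and lower bounds for the dimensions. -/

theorem gromovBoundary_apply_lt {c : List ℕ → ℕ} {M : ℕ} (hc : ∀ v, c v ≤ M) {ξ : Ray}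
    (hξ : ξ ∈ gromovBoundary c) (i : ℕ) : ξ i < M :=
  (hξ (i + 1)).2.trans_le (hc _)

theorem assouadDim_le_logb {F : Set Ray} {M : ℕ} (hM : 2 ≤ M) (hF : ∀ ξ ∈ F, ∀ i, ξ i < M) :
    assouadDim F ≤ ((Real.logb 2 M : ℝ) : EReal) := by
  have hM0 : (0 : ℝ) < M := by positivity
  -- The constant M² = 4^(log₂ M) absorbs the rounding of both r and R to powers of 1/2.
  refine sInf_le ⟨Real.logb 2 M, ⟨(M : ℝ) ^ 2, by positivity, fun r R hr hrR hR x _ => ?_⟩, rfl⟩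
  have hR0 : 0 < R := hr.trans_le hrR
  obtain ⟨k, hk1, hk2⟩ := exists_nat_pow_near_of_lt_one hR0 hR.le
    (show (0 : ℝ) < 1 / 2 by norm_num) (by norm_num)
  obtain ⟨n, hn1, hn2⟩ := exists_nat_pow_near_of_lt_one hr (hrR.trans hR.le)
    (show (0 : ℝ) < 1 / 2 by norm_num) (by norm_num)
  have hkn : k ≤ n + 1 := by
    by_contra! hlt
    have : (1 / 2 : ℝ) ^ k ≤ (1 / 2) ^ (n + 1) :=
      pow_le_pow_of_le_one (by norm_num) (by norm_num) hlt.le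
    linarith
  have hle := coverNumber_le_pow hF x hn1.le (R := R) (k := k)
    (hk2.trans_lt (by linarith [show (0 : ℝ) < (1 / 2) ^ k by positivity]))
  have hpow : ((M ^ (n + 1 - k) : ℕ) : ℝ) ≤ (M : ℝ) ^ 2 * (R / r) ^ Real.logb 2 M := by
    have h2 : (2 : ℝ) ^ (n + 1 - k) ≤ 4 * (R / r) := by
      have e1 : (2 : ℝ) ^ (n + 1 - k) * (1 / 2) ^ (n + 1) = (1 / 2) ^ k := by
        obtain ⟨d, hd⟩ := Nat.exists_eq_add_of_le hkn
        rw [hd, Nat.add_sub_cancel_left, pow_add, mul_left_comm, ← mul_pow]; norm_num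
      rw [← mul_div_assoc, le_div_iff₀ hr]
      have e2 : (2 : ℝ) ^ (n + 1 - k) * r ≤ 2 ^ (n + 1 - k) * (1 / 2) ^ n := by gcongr
      rw [pow_succ] at e1 hk1
      linarith
    have e3 : ((2 : ℝ) ^ (n + 1 - k)) ^ Real.logb 2 M = (M : ℝ) ^ (n + 1 - k) := by
      rw [← Real.rpow_natCast, ← Real.rpow_mul (by norm_num), mul_comm, Real.rpow_mul (by norm_num),
        Real.rpow_logb (by norm_num) (by norm_num) hM0, Real.rpow_natCast]
    have e4 : (4 : ℝ) ^ Real.logb 2 M = (M : ℝ) ^ 2 := by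
      rw [show (4 : ℝ) = 2 ^ (2 : ℝ) by norm_num, ← Real.rpow_mul (by norm_num), mul_comm,
        Real.rpow_mul (by norm_num), Real.rpow_logb (by norm_num) (by norm_num) hM0]
      norm_num
    push_cast
    rw [← e3, ← e4, ← Real.mul_rpow (by norm_num) (by positivity)]
    refine Real.rpow_le_rpow (by positivity) h2 (Real.logb_nonneg (by norm_num) ?_)
    exact_mod_cast (by omega : 1 ≤ M)
  calc ((coverNumber r (F ∩ Metric.closedBall x R) : ℕ∞) : ℝ≥0∞)
      ≤ (((M ^ (n + 1 - k) : ℕ) : ℕ∞) : ℝ≥0∞) := ENat.toENNReal_le.2 hle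
    _ = ENNReal.ofReal ((M ^ (n + 1 - k) : ℕ) : ℝ) := by simp
    _ ≤ _ := ENNReal.ofReal_le_ofReal hpow

theorem phiAssouadDim_le_assouadDim {E : Type*} [MetricSpace E] (φ : ℝ → ℝ) (F : Set E) :
    phiAssouadDim φ F ≤ assouadDim F := by
  refine sInf_le_sInf (image_mono ?_)
  rintro s ⟨K, hK, h⟩
  exact ⟨K, hK, fun r R hr _ hrR hR x hx => h r R hr hrR.le hR x hx⟩

theorem logb_le_phiAssouadDim {F : Set Ray} {M : ℕ} (hM : 2 ≤ M) {φ : ℝ → ℝ}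
    (hF : ∀ n : ℕ, ∃ k, n ≤ k ∧ ∃ p : ℕ → ℕ, ∀ w : ℕ → ℕ, (∀ i < fullDepth M k, w i < M) →
      ∃ ξ ∈ F, (∀ i < k, ξ i = p i) ∧ ∀ i < fullDepth M k, ξ (k + i) = w i)
    (hφ : Tendsto (fun x => φ x * |Real.log x|) (𝓝[>] 0) atTop)
    (hφC : ∀ᶠ x in 𝓝[>] (0 : ℝ), φ x ≤
      Real.log 2 / (2 * Real.log (M + 1)) * (Real.log |Real.log x| / |Real.log x|)) :
    ((Real.logb 2 M : ℝ) : EReal) ≤ phiAssouadDim φ F := by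
  refine le_sInf ?_
  rintro _ ⟨s, ⟨K, hK, h⟩, rfl⟩
  refine EReal.coe_le_coe_iff.2 ?_
  by_contra! hs
  have hM0 : (0 : ℝ) < M := by positivity
  have hlog2 : 0 < Real.log 2 := Real.log_pos (by norm_num)
  have hlogM : 0 < Real.log (M + 1) := Real.log_pos (by linarith)
  set S := Real.logb 2 M with hS
  have hS0 : 0 ≤ S := Real.logb_nonneg (by norm_num) (by exact_mod_cast (by omega : 1 ≤ M))
  have hlogk (k : ℕ) : |Real.log ((1 / 2 : ℝ) ^ k)| = k * Real.log 2 := by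
    rw [Real.log_pow, one_div, Real.log_inv, mul_neg, abs_neg, abs_of_nonneg (by positivity)]
  have hseq : Tendsto (fun k : ℕ => (1 / 2 : ℝ) ^ k) atTop (𝓝[>] 0) :=
    tendsto_nhdsWithin_iff.2 ⟨tendsto_pow_atTop_nhds_zero_of_lt_one (by norm_num) (by norm_num),
      Eventually.of_forall fun k => by simp only [mem_Ioi]; positivity⟩
  have htend : Tendsto (fun k : ℕ => φ ((1 / 2) ^ k) * k) atTop atTop := by
    have := (hφ.comp hseq).atTop_div_const hlog2
    refine this.congr fun k => ?_
    simp only [Function.comp_apply, hlogk]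
    field_simp
  have hgrow : Tendsto (fun t : ℝ => (2 : ℝ) ^ ((S - s) * t)) atTop atTop :=
    (tendsto_rpow_atTop_of_base_gt_one 2 (by norm_num)).comp
      (tendsto_id.const_mul_atTop (sub_pos.2 hs))
  -- If s < S, the factor 2^((S-s)t) eventually exceeds K·2^S, which will contradict M^⌊t⌋ ≤
  -- K·2^(ts).
  obtain ⟨n, hn⟩ := eventually_atTop.1 ((hseq.eventually hφC).and
    ((htend.eventually_ge_atTop 1).and ((hgrow.comp htend).eventually_gt_atTop (K * 2 ^ S))))
  obtain ⟨k, hnk, p, hp⟩ := hF (max n 1)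
  obtain ⟨hC, ht1, hbig⟩ := hn k ((le_max_left n 1).trans hnk)
  have hk1 : 1 ≤ k := (le_max_right n 1).trans hnk
  have hk0 : (0 : ℝ) < k := by exact_mod_cast hk1
  simp only [Function.comp_apply] at hbig
  set R : ℝ := (1 / 2) ^ k with hR
  set t := φ R * k with ht
  have hR0 : 0 < R := by positivity
  have hR1 : R < 1 := pow_lt_one₀ (by norm_num) (by norm_num) (by omega)
  have hφpos : 0 < φ R := by
    by_contra! hneg
    nlinarith
  have hRφ : R ^ φ R = (1 / 2 : ℝ) ^ t := by
    rw [ht, mul_comm, Real.rpow_mul (by norm_num), Real.rpow_natCast, ← hR]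
  set r := R ^ (1 + φ R) with hr
  have hrR : r = R * (1 / 2 : ℝ) ^ t := by
    rw [hr, Real.rpow_add hR0, Real.rpow_one, hRφ]
  have hr0 : 0 < r := by positivity
  have htpos : 0 < t := by linarith
  have hrltR : r < R := by
    rw [hrR]
    exact mul_lt_of_lt_one_right hR0 (Real.rpow_lt_one (by norm_num) (by norm_num) htpos)
  have hfloor : (⌊t⌋₊ : ℝ) ≤ t := Nat.floor_le htpos.le
  have hdepth : ⌊t⌋₊ ≤ fullDepth M k := by
    -- This is where the constant in the bound on φ comes from: the inequality says (M+1)^(2t) ≤ k,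
    -- that is, t ≤ log_(M+1) √k.
    have h1 : t * (2 * Real.log (M + 1)) ≤ Real.log k := by
      rw [hlogk] at hC
      have h2 : Real.log (k * Real.log 2) ≤ Real.log k := by
        refine Real.log_le_log (by positivity) (mul_le_of_le_one_right hk0.le ?_)
        linarith [Real.log_two_lt_d9]
      calc t * (2 * Real.log (M + 1)) = φ R * (k * (2 * Real.log (M + 1))) := by rw [ht]; ring
        _ ≤ Real.log 2 / (2 * Real.log (M + 1)) * (Real.log (k * Real.log 2) / (k * Real.log 2))
            * (k * (2 * Real.log (M + 1))) := by gcongr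
        _ = Real.log (k * Real.log 2) := by field_simp
        _ ≤ _ := h2
    refine (Nat.le_log_iff_pow_le (by omega) ?_).2 (Nat.le_sqrt.2 ?_)
    · rw [Ne, Nat.sqrt_eq_zero]; omega
    rw [← Nat.cast_le (α := ℝ), ← Real.log_le_log_iff (by positivity) hk0]
    push_cast
    rw [Real.log_mul (by positivity) (by positivity), Real.log_pow]
    nlinarith
  obtain ⟨x, hxF, hx⟩ := pow_le_coverNumber (by omega) hdepth hp hr0.le (by
    rw [pow_add, ← hR, hrR]
    have : (1 / 2 : ℝ) ^ t ≤ (1 / 2 : ℝ) ^ ⌊t⌋₊ := by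
      rw [← Real.rpow_natCast]
      exact Real.rpow_le_rpow_of_exponent_ge (by norm_num) (by norm_num) hfloor
    have h3 : 0 < R * (1 / 2 : ℝ) ^ ⌊t⌋₊ := by positivity
    have h4 : R * (1 / 2 : ℝ) ^ t ≤ R * (1 / 2 : ℝ) ^ ⌊t⌋₊ := by gcongr
    linarith)
  have hle := (ENat.toENNReal_le.2 hx).trans (h r R hr0 hr hrltR hR1 x hxF)
  have hRr : R / r = 2 ^ t := by
    rw [hrR, one_div, Real.inv_rpow (by norm_num)]
    field_simp
  have hle' : ((M ^ ⌊t⌋₊ : ℕ) : ℝ) ≤ K * (2 ^ t) ^ s := by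
    rw [hRr] at hle
    rw [← ENNReal.ofReal_le_ofReal_iff (by positivity)]
    simpa using hle
  -- Rounding t down costs at most a factor M = 2^S.
  have hMpow : (2 : ℝ) ^ (S * (t - 1)) ≤ ((M ^ ⌊t⌋₊ : ℕ) : ℝ) := by
    push_cast
    rw [Real.rpow_mul (by norm_num), hS, Real.rpow_logb (by norm_num) (by norm_num) hM0,
      ← Real.rpow_natCast]
    refine Real.rpow_le_rpow_of_exponent_le (by exact_mod_cast (by omega : 1 ≤ M)) ?_
    linarith [Nat.lt_floor_add_one t]
  have hfin := hMpow.trans hle'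
  rw [← Real.rpow_mul (by norm_num)] at hfin
  have e1 : (2 : ℝ) ^ ((S - s) * t) * 2 ^ (t * s) = 2 ^ (S * (t - 1)) * 2 ^ S := by
    rw [← Real.rpow_add (by norm_num), ← Real.rpow_add (by norm_num)]
    congr 1; ring
  have hp1 : (0 : ℝ) < 2 ^ (t * s) := by positivity
  have hp2 : (0 : ℝ) < 2 ^ S := by positivity
  nlinarith [mul_lt_mul_of_pos_right hbig hp1, mul_le_mul_of_nonneg_right hfin hp2.le]

/-! ### The maximal offspring number and the conclusion. -/

theorem exists_max_support {N : ℕ} {θ : PMF ℕ} (hN : ∀ j, N < j → θ j = 0)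
    (hm : 1 < ∑ k ∈ Finset.Icc 1 N, (θ k).toReal * (k : ℝ)) :
    ∃ M, 2 ≤ M ∧ M ≤ N ∧ θ M ≠ 0 ∧ ∀ j, M < j → θ j = 0 := by
  classical
  -- Otherwise θ charges only 0 and 1, and its mean is at most its total mass 1.
  have hex : ∃ j, 2 ≤ j ∧ j ≤ N ∧ θ j ≠ 0 := by
    by_contra! hcon
    have hle : ∑ k ∈ Finset.Icc 1 N, (θ k).toReal * (k : ℝ) ≤
        ∑ k ∈ Finset.range (N + 1), (θ k).toReal := by
      refine (Finset.sum_le_sum fun k hk => ?_).trans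
        (Finset.sum_le_sum_of_subset_of_nonneg (s := Finset.Icc 1 N) ?_ ?_)
      · rw [Finset.mem_Icc] at hk
        rcases hk.1.eq_or_lt with rfl | h2
        · simp
        · simp [hcon k h2 hk.2]
      · intro k hk
        rw [Finset.mem_Icc] at hk
        exact Finset.mem_range.2 (by omega)
      · intro k _ _; exact ENNReal.toReal_nonneg
    rw [sum_toReal_eq_one hN] at hle
    linarith
  obtain ⟨j, hj2, hjN, hj⟩ := hex
  refine ⟨Nat.findGreatest (fun j => θ j ≠ 0) N,
    hj2.trans (Nat.le_findGreatest hjN hj), Nat.findGreatest_le _,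
    Nat.findGreatest_spec (P := fun j => θ j ≠ 0) hjN hj, fun i hi => ?_⟩
  by_cases hiN : i ≤ N
  · exact not_not.1 (Nat.findGreatest_is_greatest hi hiN)
  · exact hN i (by omega)

theorem IsGaltonWatson.map_eq_treeLaw {Ω : Type*} [MeasurableSpace Ω] {θ : PMF ℕ} {P : Measure Ω}
    [IsProbabilityMeasure P] {X : List ℕ → Ω → ℕ} (h : IsGaltonWatson θ P X) :
    P.map (fun ω v => X v ω) = treeLaw θ := by
  have hlaw (v : List ℕ) : P.map (X v) = θ.toMeasure := by
    refine Measure.ext_of_singleton fun j => ?_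
    rw [Measure.map_apply (h.measurable v) (measurableSet_singleton j), h.law,
      PMF.toMeasure_apply_singleton _ _ (measurableSet_singleton j)]
  rw [h.indep.map_fun_eq_infinitePi_map h.measurable, treeLaw]
  simp_rw [hlaw]

theorem mainTheorem7 (N : ℕ) (θ : PMF ℕ) (hN : ∀ j, N < j → θ j = 0)
    (hm : 1 < ∑ k ∈ Finset.Icc 1 N, (θ k).toReal * (k : ℝ)) :
    ∃ C : ℝ, 0 < C ∧
      ∀ (Ω : Type*) [MeasurableSpace Ω] (P : Measure Ω) [IsProbabilityMeasure P]
        (X : List ℕ → Ω → ℕ), IsGaltonWatson θ P X →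
        ∀ᵐ ω ∂P, Survives (fun v => X v ω) →
          ∀ φ : ℝ → ℝ, IsDimensionFunction φ →
            Tendsto (fun x => φ x * |Real.log x|) (𝓝[>] 0) atTop →
            (∀ᶠ x in 𝓝[>] (0 : ℝ), φ x ≤ C * (Real.log |Real.log x| / |Real.log x|)) →
            phiAssouadDim φ (gromovBoundary fun v => X v ω)
              = assouadDim (gromovBoundary fun v => X v ω) := by
  obtain ⟨M, hM2, hMN, hθM, hmax⟩ := exists_max_support hN hm
  have hM0 : (0 : ℝ) < M := by positivity
  refine ⟨Real.log 2 / (2 * Real.log (M + 1)), div_pos (Real.log_pos (by norm_num))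
    (mul_pos two_pos (Real.log_pos (by linarith))), ?_⟩
  intro Ω _ P _ X hX
  -- Neither event involves φ, so a single null set serves all dimension functions at once.
  have hae := (ae_treeLaw_apply_le hmax).and (ae_frequently_fullTrees hN hm hM2 hMN hθM)
  rw [← hX.map_eq_treeLaw] at hae
  filter_upwards [ae_of_ae_map (measurable_pi_lambda _ hX.measurable).aemeasurable hae]
    with ω hω hsurv φ _ hφ hφC
  obtain ⟨hle, hfull⟩ := hω
  refine le_antisymm (phiAssouadDim_le_assouadDim _ _)
    ((assouadDim_le_logb hM2 fun ξ hξ => gromovBoundary_apply_lt hle hξ).trans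
      (logb_le_phiAssouadDim hM2 (fun n => ?_) hφ hφC))
  obtain ⟨k, hk, hc⟩ := hfull (survives_mem_survivingTrees hsurv) n
  exact ⟨k, hk, exists_prefix_of_notMem_iterate_allChildren hc⟩
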